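/- Let $M$ be a smooth manifold of dimension $m$ (without boundary) and let $\nabla$ be a smooth torsion-free connection on $TM$. Let $R$ be the curvature operator of $\nabla$ and, for a tangent vector $x$ at a point $p$, let $\mathcal J(x)\colon y\mapsto R(y,x)x$ be the Jacobi operator on $T_pM$. For an endomorphism $T$ of a finite dimensional real vector space let $\operatorname{Spec}\{T\}\subset\mathbb C$ be the set of complex roots of its characteristic polynomial. The pair $(M,\nabla)$ is called affine projective Osserman if for all non-zero tangent vectors $x,y$ (possibly at different points) there is a real number $s(x,y)\neq0$ with $$\operatorname{Spec}\{\mathcal J(y)\}=s(x,y)\cdot\operatorname{Spec}\{\mathcal J(x)\}\neq\{0\}.$$ A pseudo-Riemannian manifold $(N,g)$, with $\mathcal J$ now defined by the Levi-Civita connection, is called spacelike (resp. timelike) projective Osserman if for all tangent vectors $x,y$ (possibly at different points) with $g(x,x)=g(y,y)=1$ (resp. $=-1$) there is a real number $s(x,y)\ne0$ satisfying the same condition. Let $\Phi$ be a smooth symmetric $2$-tensor on $M$. Local coordinates $(x^1,\dots,x^m)$ on $M$ induce coordinates $(x^1,\dots,x^m,y_1,\dots,y_m)$ on $T^*M$ by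 writing a covector as $\sum_i y_i\,dx^i$. The deformed Riemannian extension $g_{\nabla,\Phi}$ is the pseudo-Riemannian metric on $T^*M$ given in all such coordinates by $$g_{\nabla,\Phi}(\partial_{x^i},\partial_{x^j})=-2\sum_k y_k\Gamma_{ij}{}^k(x)+\Phi_{ij}(x),\qquad g_{\nabla,\Phi}(\partial_{x^i},\partial_{y_j})=\delta_i^j,\qquad g_{\nabla,\Phi}(\partial_{y_i},\partial_{y_j})=0,$$ where $\Gamma_{ij}{}^k$ are the Christoffel symbols of $\nabla$. Theorem 1.8. The following assertions are equivalent: (1) $(M,\nabla)$ is affine projective Osserman; (2) $(T^*M,g_{\nabla,\Phi})$ is spacelike projective Osserman; (3) $(T^*M,g_{\nabla,\Phi})$ is timelike projective Osserman. -/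

import Mathlib

set_option maxSynthPendingDepth 3

open Bundle
open scoped Manifold ContDiff

noncomputable section

namespace Osserman

/-! ### Linear algebra: the spectrum -/

/-- The spectrum of an endomorphism of a finite dimensional real vector space: the set of complex
roots of its characteristic polynomial. -/
def spec {V : Type*} [AddCommGroup V] [Module ℝ V] [Module.Finite ℝ V] (T : V →ₗ[ℝ] V) : Set ℂ :=
  {μ : ℂ | (T.charpoly.map (algebraMap ℝ ℂ)).IsRoot μ}

/-- `S = s • S' ≠ {0}` for some nonzero real number `s`. -/
def ProjEquiv (S S' : Set ℂ) : Prop :=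
  ∃ s : ℝ, s ≠ 0 ∧ S = (fun μ : ℂ => (s : ℂ) * μ) '' S' ∧ S ≠ {0}

/-- The pullback `(u, v) ↦ h(A u, A v)` of a bilinear form `h` by a linear map `A`. -/
def pullbackForm {V W : Type*} [AddCommGroup V] [Module ℝ V] [TopologicalSpace V]
    [IsTopologicalAddGroup V] [ContinuousConstSMul ℝ V]
    [AddCommGroup W] [Module ℝ W] [TopologicalSpace W]
    [IsTopologicalAddGroup W] [ContinuousConstSMul ℝ W]
    (h : W →L[ℝ] W →L[ℝ] ℝ) (A : V →L[ℝ] W) : V →L[ℝ] V →L[ℝ] ℝ :=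
  ContinuousLinearMap.precomp ℝ A ∘L h ∘L A

@[simp]
theorem pullbackForm_apply {V W : Type*} [AddCommGroup V] [Module ℝ V] [TopologicalSpace V]
    [IsTopologicalAddGroup V] [ContinuousConstSMul ℝ V]
    [AddCommGroup W] [Module ℝ W] [TopologicalSpace W]
    [IsTopologicalAddGroup W] [ContinuousConstSMul ℝ W]
    (h : W →L[ℝ] W →L[ℝ] ℝ) (A : V →L[ℝ] W) (u v : V) :
    pullbackForm h A u v = h (A u) (A v) := rfl

/-! ### Curvature in a coordinate chart -/

section Local

variable {F : Type*} [NormedAddCommGroup F] [NormedSpace ℝ F]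

/-- The curvature operator `R(u, v) w` at `z` of the connection with Christoffel symbols `Γ` on an
open set of `F`; here `Γ z u v` is `∇_u v` for constant vector fields `u, v`. In components
`R_{ijk}^l = ∂_i Γ_{jk}^l - ∂_j Γ_{ik}^l + Γ_{in}^l Γ_{jk}^n - Γ_{jn}^l Γ_{ik}^n`. -/
def curvature (Γ : F → F →L[ℝ] F →L[ℝ] F) (z u v w : F) : F :=
  fderiv ℝ Γ z u v w - fderiv ℝ Γ z v u w + Γ z u (Γ z v w) - Γ z v (Γ z u w)

/-- The Jacobi operator `y ↦ R(y, x) x` at `z`. -/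
def jacobi (Γ : F → F →L[ℝ] F →L[ℝ] F) (z x : F) : F →ₗ[ℝ] F where
  toFun y := curvature Γ z y x x
  map_add' y y' := by
    simp only [curvature, map_add, add_apply]
    abel
  map_smul' c y := by
    simp only [curvature, map_smul, smul_apply, RingHom.id_apply, smul_sub,
      smul_add]

/-- The Christoffel symbols of the first kind of a metric `G` on an open set of `F`:
`(u, v, w) ↦ (∂_u G(v, w) + ∂_v G(u, w) - ∂_w G(u, v)) / 2`. -/
def christoffelFirstKind (G : F → F →L[ℝ] F →L[ℝ] ℝ) (z : F) : F →L[ℝ] F →L[ℝ] F →L[ℝ] ℝ :=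
  (1 / 2 : ℝ) • (fderiv ℝ G z + (fderiv ℝ G z).flip -
    ((ContinuousLinearMap.flipₗᵢ ℝ F F ℝ).toContinuousLinearEquiv :
      (F →L[ℝ] F →L[ℝ] ℝ) →L[ℝ] F →L[ℝ] F →L[ℝ] ℝ) ∘L (fderiv ℝ G z).flip)

theorem christoffelFirstKind_apply (G : F → F →L[ℝ] F →L[ℝ] ℝ) (z u v w : F) :
    christoffelFirstKind G z u v w =
      (fderiv ℝ G z u v w + fderiv ℝ G z v u w - fderiv ℝ G z w u v) / 2 := by
  simp [christoffelFirstKind]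
  ring

/-- The Christoffel symbols (of the second kind) of the Levi-Civita connection of a metric `G` on
an open set of `F`; the vector `Γ(u, v)` is determined by
`G(Γ(u, v), w) = (∂_u G(v, w) + ∂_v G(u, w) - ∂_w G(u, v)) / 2`. -/
def leviCivitaChristoffel (G : F → F →L[ℝ] F →L[ℝ] ℝ) (z : F) : F →L[ℝ] F →L[ℝ] F :=
  (ContinuousLinearMap.compL ℝ F (F →L[ℝ] ℝ) F (G z).inverse) ∘L christoffelFirstKind G z

/-- On a nondegenerate symmetric metric the Christoffel symbols satisfy their defining equation. -/
theorem leviCivitaChristoffel_spec (G : F → F →L[ℝ] F →L[ℝ] ℝ) (z : F)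
    (hG : (G z).IsInvertible) (u v w : F) :
    G z (leviCivitaChristoffel G z u v) w =
      (fderiv ℝ G z u v w + fderiv ℝ G z v u w - fderiv ℝ G z w u v) / 2 := by
  rw [← christoffelFirstKind_apply]
  obtain ⟨e, he⟩ := hG
  simp [leviCivitaChristoffel, ← he]

end Local

/-! ### Coordinate frames on a manifold -/

section Manifold

variable {E : Type*} [NormedAddCommGroup E] [NormedSpace ℝ E]
  {H : Type*} [TopologicalSpace H] (I : ModelWithCorners ℝ E H)
  {M : Type*} [TopologicalSpace M] [ChartedSpace H M] [IsManifold I ∞ M]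

/-- The coordinate frame of the preferred chart at `p`: the tangent vector at `q` whose components
with respect to that chart are `u` (it is `0` if `q` is not in the domain of the chart). For fixed
`p` and `u` this is the vector field on the chart domain with constant components `u`. -/
def coordFrame (p q : M) : E →L[ℝ] TangentSpace I q :=
  (trivializationAt E (TangentSpace I : M → Type _) p).symmL ℝ q

/-- The components of a tangent vector at `q` with respect to the preferred chart at `p`
(they are `0` if `q` is not in the domain of the chart). -/
def coordComponents (p q : M) : TangentSpace I q →L[ℝ] E :=
  (trivializationAt E (TangentSpace I : M → Type _) p).continuousLinearMapAt ℝ q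

theorem coordComponents_eq_zero (p q : M)
    (hq : q ∉ (trivializationAt E (TangentSpace I : M → Type _) p).baseSet) :
    coordComponents I p q = 0 := by
  ext v
  simp [coordComponents, Trivialization.continuousLinearMapAt_apply,
    Trivialization.linearMapAt_def_of_notMem _ hq]

theorem mdifferentiableAt_coordFrame (p q : M) (v : E)
    (hq : q ∈ (trivializationAt E (TangentSpace I : M → Type _) p).baseSet) :
    MDifferentiableAt I (I.prod 𝓘(ℝ, E))
      (fun q => TotalSpace.mk' E q (coordFrame I p q v)) q := by
  have h : ContMDiffOn I (I.prod 𝓘(ℝ, E)) 1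
      (fun q => TotalSpace.mk' E q (coordFrame I p q v))
      (trivializationAt E (TangentSpace I : M → Type _) p).baseSet := by
    rw [Trivialization.contMDiffOn_section_baseSet_iff]
    refine (contMDiffOn_const (c := v)).congr ?_
    intro y hy
    rw [coordFrame, Trivialization.symmL_apply _ hy]
    exact congrArg Prod.snd (Trivialization.apply_mk_symm _ hy v)
  have hq' := (trivializationAt E (TangentSpace I : M → Type _) p).open_baseSet.mem_nhds hq
  exact (h.contMDiffAt hq').mdifferentiableAt one_ne_zero

/-! ### Affine manifolds -/

section Affine

variable [FiniteDimensional ℝ E]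

/-- The Christoffel symbols at `q` of a connection `∇` on `TM`, with respect to the preferred chart
at `p`: `christoffel I ∇ p q u v` is the vector of components of `∇_u v` at `q`, where `u` and `v`
are extended to vector fields with constant components. In components, it is `Γ_{ij}^k u^i v^j`. -/
def christoffel (D : CovariantDerivative I E (TangentSpace I : M → Type _)) (p q : M) :
    E →L[ℝ] E →L[ℝ] E :=
  (LinearMap.toContinuousLinearMap (𝕜 := ℝ) (E := E) (F' := E →L[ℝ] E)
    { toFun := fun v =>
        coordComponents I p q ∘L D (fun q' => coordFrame I p q' v) q ∘L coordFrame I p q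
      map_add' := fun v w => by
        by_cases hq : q ∈ (trivializationAt E (TangentSpace I : M → Type _) p).baseSet
        · have h := D.isCovariantDerivativeOn.add (mdifferentiableAt_coordFrame I p q v hq)
            (mdifferentiableAt_coordFrame I p q w hq)
          have e : (fun q' => coordFrame I p q' (v + w)) =
              (fun q' => coordFrame I p q' v) + fun q' => coordFrame I p q' w := by
            funext q'
            simp
          rw [e]
          erw [h]
          ext u
          simp
        · simp [coordComponents_eq_zero I p q hq]
      map_smul' := fun c v => by
        by_cases hq : q ∈ (trivializationAt E (TangentSpace I : M → Type _) p).baseSet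
        · have h := D.isCovariantDerivativeOn.smul_const c
            (mdifferentiableAt_coordFrame I p q v hq)
          have e : (fun q' => coordFrame I p q' (c • v)) =
              c • (fun q' => coordFrame I p q' v) := by
            funext q'
            simp
          rw [e]
          erw [h]
          ext u
          simp
        · simp [coordComponents_eq_zero I p q hq] }).flip

theorem christoffel_apply (D : CovariantDerivative I E (TangentSpace I : M → Type _)) (p q : M)
    (u v : E) : christoffel I D p q u v =
      coordComponents I p q (D (fun q' => coordFrame I p q' v) q (coordFrame I p q u)) := rfl

/-- The Jacobi operator `y ↦ R(y, x) x` of the connection `∇` on `TM`, for `x` tangent at `p`,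
written in the coordinates of the preferred chart at `p`. -/
def affineJacobi (D : CovariantDerivative I E (TangentSpace I : M → Type _)) {p : M}
    (x : TangentSpace I p) : E →ₗ[ℝ] E :=
  jacobi (fun z => christoffel I D p ((extChartAt I p).symm z)) (extChartAt I p p)
    (coordComponents I p p x)

/-- `(M, ∇)` is affine projective Osserman: for all nonzero tangent vectors `x`, `y` (possibly at
different points), `Spec J(y) = s(x, y) • Spec J(x) ≠ {0}` for some real `s(x, y) ≠ 0`. -/
def IsAffineProjectiveOsserman (D : CovariantDerivative I E (TangentSpace I : M → Type _)) :
    Prop :=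
  ∀ (p q : M) (x : TangentSpace I p) (y : TangentSpace I q), x ≠ 0 → y ≠ 0 →
    ProjEquiv (spec (affineJacobi I D y)) (spec (affineJacobi I D x))

end Affine

/-! ### Covariant 2-tensors and pseudo-Riemannian manifolds -/

/-- Smoothness of a covariant 2-tensor field. -/
def IsSmoothTwoTensor (h : ∀ p : M, TangentSpace I p →L[ℝ] TangentSpace I p →L[ℝ] ℝ) : Prop :=
  ContMDiff I (I.prod 𝓘(ℝ, E →L[ℝ] E →L[ℝ] ℝ)) ∞
    (fun p => TotalSpace.mk' (E →L[ℝ] E →L[ℝ] ℝ) p (h p))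

/-- A pseudo-Riemannian metric: a smooth field of nondegenerate symmetric bilinear forms. -/
structure IsPseudoRiemannianMetric
    (g : ∀ p : M, TangentSpace I p →L[ℝ] TangentSpace I p →L[ℝ] ℝ) : Prop where
  smooth : IsSmoothTwoTensor I g
  symm : ∀ p x y, g p x y = g p y x
  nondegenerate : ∀ p x, (∀ y, g p x y = 0) → x = 0

/-- The components of a covariant 2-tensor field with respect to the preferred chart at `p`, as a
function on the target of that chart. -/
def localComponents (h : ∀ p : M, TangentSpace I p →L[ℝ] TangentSpace I p →L[ℝ] ℝ) (p : M)
    (z : E) : E →L[ℝ] E →L[ℝ] ℝ :=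
  pullbackForm (h ((extChartAt I p).symm z)) (coordFrame I p ((extChartAt I p).symm z))

/-- The Jacobi operator `y ↦ R(y, x) x` of the Levi-Civita connection of a pseudo-Riemannian metric
`g`, for `x` tangent at `p`, written in the coordinates of the preferred chart at `p`. -/
def metricJacobi (g : ∀ p : M, TangentSpace I p →L[ℝ] TangentSpace I p →L[ℝ] ℝ) {p : M}
    (x : TangentSpace I p) : E →ₗ[ℝ] E :=
  jacobi (leviCivitaChristoffel (localComponents I g p)) (extChartAt I p p)
    (coordComponents I p p x)

variable [FiniteDimensional ℝ E]

/-- `g` is a pseudo-Riemannian metric on `M`, and for all tangent vectors `x`, `y` (possibly at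
different points) with `g(x, x) = g(y, y) = ε`, one has `Spec J(y) = s(x, y) • Spec J(x) ≠ {0}` for
some real `s(x, y) ≠ 0`. -/
structure IsProjectiveOssermanOnPseudosphere (ε : ℝ)
    (g : ∀ p : M, TangentSpace I p →L[ℝ] TangentSpace I p →L[ℝ] ℝ) : Prop where
  isMetric : IsPseudoRiemannianMetric I g
  projEquiv : ∀ (p q : M) (x : TangentSpace I p) (y : TangentSpace I q), g p x x = ε →
    g q y y = ε → ProjEquiv (spec (metricJacobi I g y)) (spec (metricJacobi I g x))

/-- `(M, g)` is a spacelike projective Osserman manifold. -/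
def IsSpacelikeProjectiveOsserman
    (g : ∀ p : M, TangentSpace I p →L[ℝ] TangentSpace I p →L[ℝ] ℝ) : Prop :=
  IsProjectiveOssermanOnPseudosphere I 1 g

/-- `(M, g)` is a timelike projective Osserman manifold. -/
def IsTimelikeProjectiveOsserman
    (g : ∀ p : M, TangentSpace I p →L[ℝ] TangentSpace I p →L[ℝ] ℝ) : Prop :=
  IsProjectiveOssermanOnPseudosphere I (-1) g

/-! ### The cotangent bundle and the deformed Riemannian extension -/

variable (M) in
/-- The cotangent bundle `T*M`. Its preferred chart at a point over `p` is given by the canonical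
coordinates `(x^1, …, x^m, y_1, …, y_m)` associated with the preferred chart at `p`. -/
abbrev CotangentBundle : Type _ :=
  TotalSpace (E →L[ℝ] ℝ) (fun p : M => TangentSpace I p →L[ℝ] ℝ)

/-- The deformed Riemannian extension in the canonical coordinates associated with the preferred
chart at `p`, at the cotangent vector `η` at `q`. With `a = a^i ∂_{x_i} + α_i ∂_{y_i}` written as
`(a, α)`, it is `((a, α), (b, β)) ↦ (-2 y_k Γ_{ij}^k + Φ_{ij}) a^i b^j + α_i b^i + β_i a^i`. -/
def deformedExtensionLocal (D : CovariantDerivative I E (TangentSpace I : M → Type _))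
    (Φ : ∀ p : M, TangentSpace I p →L[ℝ] TangentSpace I p →L[ℝ] ℝ) (p q : M)
    (η : TangentSpace I q →L[ℝ] ℝ) :
    (E × (E →L[ℝ] ℝ)) →L[ℝ] (E × (E →L[ℝ] ℝ)) →L[ℝ] ℝ :=
  let π₁ : (E × (E →L[ℝ] ℝ)) →L[ℝ] E := ContinuousLinearMap.fst ℝ E (E →L[ℝ] ℝ)
  let π₂ : (E × (E →L[ℝ] ℝ)) →L[ℝ] (E →L[ℝ] ℝ) := ContinuousLinearMap.snd ℝ E (E →L[ℝ] ℝ)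
  let y : E →L[ℝ] ℝ := η ∘L coordFrame I p q
  let yΓ : E →L[ℝ] E →L[ℝ] ℝ := ContinuousLinearMap.compL ℝ E E ℝ y ∘L christoffel I D p q
  let Φ' : E →L[ℝ] E →L[ℝ] ℝ := pullbackForm (Φ q) (coordFrame I p q)
  let P : (E × (E →L[ℝ] ℝ)) →L[ℝ] (E × (E →L[ℝ] ℝ)) →L[ℝ] ℝ :=
    (ContinuousLinearMap.id ℝ (E →L[ℝ] ℝ)).bilinearComp π₂ π₁
  ((-2 : ℝ) • yΓ + Φ').bilinearComp π₁ π₁ + P + P.flip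

theorem deformedExtensionLocal_apply
    (D : CovariantDerivative I E (TangentSpace I : M → Type _))
    (Φ : ∀ p : M, TangentSpace I p →L[ℝ] TangentSpace I p →L[ℝ] ℝ) (p q : M)
    (η : TangentSpace I q →L[ℝ] ℝ) (a b : E) (α β : E →L[ℝ] ℝ) :
    deformedExtensionLocal I D Φ p q η (a, α) (b, β) =
      -2 * η (coordFrame I p q (christoffel I D p q a b)) +
        Φ q (coordFrame I p q a) (coordFrame I p q b) + α b + β a := by
  simp [deformedExtensionLocal]

/-- The deformed Riemannian extension `g_{∇,Φ}` on `T*M`. Its local expression does not depend on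
the choice of canonical coordinates; at a point over `p` we use those of the preferred chart at `p`.
-/
def deformedRiemannianExtension (D : CovariantDerivative I E (TangentSpace I : M → Type _))
    (Φ : ∀ p : M, TangentSpace I p →L[ℝ] TangentSpace I p →L[ℝ] ℝ) (ξ : CotangentBundle I M) :
    TangentSpace (I.prod 𝓘(ℝ, E →L[ℝ] ℝ)) ξ →L[ℝ]
      TangentSpace (I.prod 𝓘(ℝ, E →L[ℝ] ℝ)) ξ →L[ℝ] ℝ :=
  pullbackForm (deformedExtensionLocal I D Φ ξ.proj ξ.proj ξ.snd)
    (coordComponents (I.prod 𝓘(ℝ, E →L[ℝ] ℝ)) ξ ξ)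

end Manifold

end Osserman

end

/-!
Write `(x, y)` for the canonical coordinates on `T*M` and `(a, α)` for tangent vectors in them. The
Christoffel symbols of the deformed Riemannian extension have the form
`L((a, α), (b, β)) = (Γ(a, b), -α Γ(b, ·) - β Γ(a, ·) + S(a, b))` with `S` affine in `y`
(`leviCivitaChristoffel_extensionMetric_fst`, `leviCivitaChristoffel_extensionMetric_snd_apply`).
Their first component does not involve `y`, `α`, `β`, so the projection `T*M → M` intertwines the
curvature operators, and the Jacobi operator of a vector `X` over `x` is block triangular with
respect to the vertical subspace. On the vertical subspace it is the transpose of `J(x)`, hence its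
characteristic polynomial is that of `J(x)` squared, and `Spec J(X) = Spec J(x)`
(`spec_jacobi_extensionMetric`).

A vector with `g(X, X) = ±1` is not vertical, as vertical vectors are null. Conversely every nonzero
`x` is the projection of some `X` with `g(X, X) = ±1`: in `g((a, α), (a, α)) = c(a) + 2 α(a)` the
covector `α` is arbitrary. So the condition on nonzero vectors of `M` and the conditions on the two
pseudospheres of `T*M` involve the same spectra (`isAffineProjectiveOsserman_iff`).

The metric at a point of `T*M` is defined through the chart centred at that point, whereas its
derivatives are taken in one fixed chart. The two descriptions agree because the second derivatives
of the transition map `φ`, which enter once through the transformation law of the Christoffel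
symbols (`christoffel_transition`) and once through the derivative of
`(x, y) ↦ (φ x, y ∘ (Dφ x)⁻¹)` (`coordComponents_coordFrame_cotangentBundle`), cancel
(`localComponents_deformedRiemannianExtension`). Smoothness of the metric follows.
-/

noncomputable section

namespace Osserman

/-! ### The spectrum of a block triangular endomorphism -/

section BlockTriangular

variable {V : Type*} [NormedAddCommGroup V] [NormedSpace ℝ V] [FiniteDimensional ℝ V]

/-- An endomorphism of `V × V*` that preserves `V*`, acts there as the transpose of `J`, and induces
`J` on the quotient `V`, has the square of the characteristic polynomial of `J`. -/
theorem charpoly_eq_sq_of_blockTriangular (T : V × (V →L[ℝ] ℝ) →ₗ[ℝ] V × (V →L[ℝ] ℝ))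
    (J : V →ₗ[ℝ] V) (h₁ : ∀ v, (T v).1 = J v.1)
    (h₂ : ∀ (η : V →L[ℝ] ℝ) (w : V), (T (0, η)).2 w = η (J w)) :
    T.charpoly = J.charpoly ^ 2 := by
  classical
  let b := Module.finBasis ℝ V
  let b' : Module.Basis _ ℝ (V →L[ℝ] ℝ) := b.dualBasis.map LinearMap.toContinuousLinearMap
  have hM : LinearMap.toMatrix (b.prod b') (b.prod b') T =
      Matrix.fromBlocks (LinearMap.toMatrix b b J) 0
        (Matrix.of fun i j => b'.repr (T (b j, 0)).2 i) (LinearMap.toMatrix b b J).transpose := by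
    ext (i | i) (j | j)
    · simp [LinearMap.toMatrix_apply, h₁]
    · simp [LinearMap.toMatrix_apply, h₁]
    · simp [LinearMap.toMatrix_apply]
    · simp [LinearMap.toMatrix_apply, b', h₂]
  rw [← LinearMap.charpoly_toMatrix T (b.prod b'), hM, Matrix.charpoly_fromBlocks_zero₁₂,
    Matrix.charpoly_transpose, LinearMap.charpoly_toMatrix, sq]

theorem spec_eq_of_blockTriangular (T : V × (V →L[ℝ] ℝ) →ₗ[ℝ] V × (V →L[ℝ] ℝ))
    (J : V →ₗ[ℝ] V) (h₁ : ∀ v, (T v).1 = J v.1)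
    (h₂ : ∀ (η : V →L[ℝ] ℝ) (w : V), (T (0, η)).2 w = η (J w)) :
    spec T = spec J := by
  ext μ
  simp [spec, charpoly_eq_sq_of_blockTriangular T J h₁ h₂, Polynomial.IsRoot]

end BlockTriangular

/-! ### The extension metric in canonical coordinates -/

section LocalExtension

variable {V : Type*} [NormedAddCommGroup V] [NormedSpace ℝ V]

/-- The bilinear form `((a, α), (b, β)) ↦ (-2 y ∘ Γ + Φ)(a, b) + α b + β a` on `V × V*`. -/
def extensionForm (Γ : V →L[ℝ] V →L[ℝ] V) (Φ : V →L[ℝ] V →L[ℝ] ℝ) (y : V →L[ℝ] ℝ) :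
    (V × (V →L[ℝ] ℝ)) →L[ℝ] (V × (V →L[ℝ] ℝ)) →L[ℝ] ℝ :=
  let π₁ : (V × (V →L[ℝ] ℝ)) →L[ℝ] V := ContinuousLinearMap.fst ℝ V (V →L[ℝ] ℝ)
  let π₂ : (V × (V →L[ℝ] ℝ)) →L[ℝ] (V →L[ℝ] ℝ) := ContinuousLinearMap.snd ℝ V (V →L[ℝ] ℝ)
  let P : (V × (V →L[ℝ] ℝ)) →L[ℝ] (V × (V →L[ℝ] ℝ)) →L[ℝ] ℝ :=
    (ContinuousLinearMap.id ℝ (V →L[ℝ] ℝ)).bilinearComp π₂ π₁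
  ((-2 : ℝ) • (ContinuousLinearMap.compL ℝ V V ℝ y ∘L Γ) + Φ).bilinearComp π₁ π₁ + P + P.flip

@[simp]
theorem extensionForm_apply (Γ : V →L[ℝ] V →L[ℝ] V) (Φ : V →L[ℝ] V →L[ℝ] ℝ) (y : V →L[ℝ] ℝ)
    (A B : V × (V →L[ℝ] ℝ)) :
    extensionForm Γ Φ y A B = -2 * y (Γ A.1 B.1) + Φ A.1 B.1 + A.2 B.1 + B.2 A.1 := by
  simp [extensionForm]

/-- The form is nondegenerate, whatever its restriction `-2 y ∘ Γ + Φ` to `V` is. -/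
theorem eq_zero_of_extensionForm_eq_zero (Γ : V →L[ℝ] V →L[ℝ] V) (Φ : V →L[ℝ] V →L[ℝ] ℝ)
    (y : V →L[ℝ] ℝ) (A : V × (V →L[ℝ] ℝ)) (h : ∀ B, extensionForm Γ Φ y A B = 0) : A = 0 := by
  have h₁ : A.1 = 0 := by
    by_contra hne
    obtain ⟨β, -, hβ⟩ := exists_dual_vector ℝ A.1 (norm_ne_zero_iff.2 hne)
    have := h (0, β)
    simp only [extensionForm_apply, map_zero, mul_zero, add_zero, zero_add] at this
    rw [hβ] at this
    simp [hne] at this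
  have h₂ : A.2 = 0 := by
    ext b
    simpa [h₁] using h (b, 0)
  exact Prod.ext h₁ h₂

theorem isInvertible_extensionForm [FiniteDimensional ℝ V] (Γ : V →L[ℝ] V →L[ℝ] V)
    (Φ : V →L[ℝ] V →L[ℝ] ℝ) (y : V →L[ℝ] ℝ) : (extensionForm Γ Φ y).IsInvertible := by
  have hinj : Function.Injective (extensionForm Γ Φ y).toLinearMap := by
    rw [injective_iff_map_eq_zero]
    intro A hA
    exact eq_zero_of_extensionForm_eq_zero Γ Φ y A fun B => by
      simpa using congrArg (fun f : (V × (V →L[ℝ] ℝ)) →L[ℝ] ℝ => f B) hA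
  have hdim : Module.finrank ℝ (V × (V →L[ℝ] ℝ)) =
      Module.finrank ℝ ((V × (V →L[ℝ] ℝ)) →L[ℝ] ℝ) := by
    rw [← (LinearMap.toContinuousLinearMap (𝕜 := ℝ) (E := V × (V →L[ℝ] ℝ))
      (F' := ℝ)).finrank_eq]
    exact (Subspace.dual_finrank_eq).symm
  exact ⟨(LinearMap.linearEquivOfInjective _ hinj hdim).toContinuousLinearEquiv, by ext <;> rfl⟩

/-- The metric of the deformed Riemannian extension in canonical coordinates, for Christoffel
symbols `Γ` and a tensor `Φ` on the base, both functions of the base coordinates. -/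
def extensionMetric (Γ : V → V →L[ℝ] V →L[ℝ] V) (Φ : V → V →L[ℝ] V →L[ℝ] ℝ)
    (z : V × (V →L[ℝ] ℝ)) : (V × (V →L[ℝ] ℝ)) →L[ℝ] (V × (V →L[ℝ] ℝ)) →L[ℝ] ℝ :=
  extensionForm (Γ z.1) (Φ z.1) z.2

variable {Γ : V → V →L[ℝ] V →L[ℝ] V} {Φ : V → V →L[ℝ] V →L[ℝ] ℝ}

theorem contDiffAt_extensionMetric {n : WithTop ℕ∞} {z : V × (V →L[ℝ] ℝ)}
    (hΓ : ContDiffAt ℝ n Γ z.1) (hΦ : ContDiffAt ℝ n Φ z.1) :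
    ContDiffAt ℝ n (extensionMetric Γ Φ) z := by
  unfold extensionMetric extensionForm
  have h₁ : ContDiffAt ℝ n (fun z : V × (V →L[ℝ] ℝ) => Γ z.1) z := hΓ.comp z contDiffAt_fst
  have h₂ : ContDiffAt ℝ n (fun z : V × (V →L[ℝ] ℝ) => Φ z.1) z := hΦ.comp z contDiffAt_fst
  have h₃ : ContDiffAt ℝ n (fun z : V × (V →L[ℝ] ℝ) =>
      (-2 : ℝ) • (ContinuousLinearMap.compL ℝ V V ℝ z.2 ∘L Γ z.1) + Φ z.1) z :=
    ((((ContinuousLinearMap.compL ℝ V V ℝ).contDiff.contDiffAt.comp z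
      contDiffAt_snd).clm_comp h₁).const_smul _).add h₂
  refine ContDiffAt.add (ContDiffAt.add ?_ contDiffAt_const) contDiffAt_const
  let Q : (V →L[ℝ] V →L[ℝ] ℝ) →L[ℝ] (V × (V →L[ℝ] ℝ)) →L[ℝ] (V × (V →L[ℝ] ℝ)) →L[ℝ] ℝ :=
    (ContinuousLinearMap.compL ℝ (V × (V →L[ℝ] ℝ)) (V →L[ℝ] ℝ) ((V × (V →L[ℝ] ℝ)) →L[ℝ] ℝ)
      (ContinuousLinearMap.precomp ℝ (ContinuousLinearMap.fst ℝ V (V →L[ℝ] ℝ)))) ∘L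
      (ContinuousLinearMap.precomp (V →L[ℝ] ℝ) (ContinuousLinearMap.fst ℝ V (V →L[ℝ] ℝ)))
  exact Q.contDiff.contDiffAt.comp z h₃

theorem fderiv_extensionMetric_apply {z : V × (V →L[ℝ] ℝ)} (hΓ : ContDiffAt ℝ 1 Γ z.1)
    (hΦ : ContDiffAt ℝ 1 Φ z.1) (A B C : V × (V →L[ℝ] ℝ)) :
    fderiv ℝ (extensionMetric Γ Φ) z A B C =
      -2 * (A.2 (Γ z.1 B.1 C.1) + z.2 (fderiv ℝ Γ z.1 A.1 B.1 C.1)) +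
        fderiv ℝ Φ z.1 A.1 B.1 C.1 := by
  have hG := ((contDiffAt_extensionMetric hΓ hΦ).differentiableAt one_ne_zero).hasFDerivAt
  have hG' := (hG.clm_apply (hasFDerivAt_const B z)).clm_apply (hasFDerivAt_const C z)
  have hΓ' := (hΓ.differentiableAt one_ne_zero).hasFDerivAt.comp z
    (hasFDerivAt_fst (𝕜 := ℝ) (p := z))
  have hΦ' := (hΦ.differentiableAt one_ne_zero).hasFDerivAt.comp z
    (hasFDerivAt_fst (𝕜 := ℝ) (p := z))
  have e₁ := (hΓ'.clm_apply (hasFDerivAt_const B.1 z)).clm_apply (hasFDerivAt_const C.1 z)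
  have e₂ := (hΦ'.clm_apply (hasFDerivAt_const B.1 z)).clm_apply (hasFDerivAt_const C.1 z)
  have e₃ := ((((hasFDerivAt_snd (𝕜 := ℝ) (p := z)).clm_apply e₁).const_mul (-2)).add
    e₂).add_const (B.2 C.1) |>.add_const (C.2 B.1)
  have := hG'.unique (e₃.congr_of_eventuallyEq (.of_forall fun y => by simp [extensionMetric]))
  have := congrArg (fun f : (V × (V →L[ℝ] ℝ)) →L[ℝ] ℝ => f A) this
  simp at this
  rw [this]
  ring

end LocalExtension

/-! ### The Levi-Civita connection and the curvature of the model extension -/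

section LocalExtension

variable {V : Type*} [NormedAddCommGroup V] [NormedSpace ℝ V]

theorem curvature_congr {Γ Γ' : V → V →L[ℝ] V →L[ℝ] V} {z : V} (h : Γ =ᶠ[nhds z] Γ') :
    curvature Γ z = curvature Γ' z := by
  funext u v w
  simp only [curvature, h.fderiv_eq, h.eq_of_nhds]

theorem leviCivitaChristoffel_congr {G G' : V → V →L[ℝ] V →L[ℝ] ℝ} {z : V}
    (h : G =ᶠ[nhds z] G') : leviCivitaChristoffel G =ᶠ[nhds z] leviCivitaChristoffel G' := by
  filter_upwards [h, h.fderiv (𝕜 := ℝ)] with x hx hx'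
  simp only [leviCivitaChristoffel, christoffelFirstKind, hx, hx']

theorem jacobi_leviCivitaChristoffel_congr {G G' : V → V →L[ℝ] V →L[ℝ] ℝ} {z : V}
    (h : G =ᶠ[nhds z] G') (X : V) :
    jacobi (leviCivitaChristoffel G) z X = jacobi (leviCivitaChristoffel G') z X := by
  ext Y
  simp only [jacobi, LinearMap.coe_mk, AddHom.coe_mk,
    curvature_congr (leviCivitaChristoffel_congr h)]

set_option synthInstance.maxHeartbeats 200000 in
/-- Qualitative differentiability suffices: it lets the derivatives of the Christoffel symbols of
the extension be computed entry by entry, and along vertical lines. -/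
theorem differentiableAt_leviCivitaChristoffel [CompleteSpace V] {G : V → V →L[ℝ] V →L[ℝ] ℝ} {z : V}
    (hG : ContDiffAt ℝ 2 G z) (hz : (G z).IsInvertible) :
    DifferentiableAt ℝ (leviCivitaChristoffel G) z := by
  have hG' : ContDiffAt ℝ 1 (fderiv ℝ G) z := hG.fderiv_right (by norm_num)
  have hflip : ContDiffAt ℝ 1 (fun z => (fderiv ℝ G z).flip) z :=
    (ContinuousLinearMap.flipₗᵢ ℝ V V (V →L[ℝ] ℝ)).contDiff.contDiffAt.comp z hG'
  have h₁ : ContDiffAt ℝ 1 (christoffelFirstKind G) z := by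
    unfold christoffelFirstKind
    exact ((hG'.add hflip).sub (contDiffAt_const.clm_comp hflip)).const_smul _
  have h₂ : ContDiffAt ℝ 1 (fun z => (G z).inverse) z := by
    obtain ⟨e, he⟩ := hz
    have := contDiffAt_map_inverse (𝕜 := ℝ) (n := 1) e
    rw [he] at this
    exact this.comp z (hG.of_le (by norm_num))
  unfold leviCivitaChristoffel
  exact (((ContinuousLinearMap.compL ℝ V (V →L[ℝ] ℝ) V).contDiff.contDiffAt.comp z
    h₂).clm_comp h₁).differentiableAt one_ne_zero

variable {Γ : V → V →L[ℝ] V →L[ℝ] V} {Φ : V → V →L[ℝ] V →L[ℝ] ℝ}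

section Christoffel

variable [FiniteDimensional ℝ V]

/-- The Levi-Civita connection of the extension projects to the connection on the base. -/
theorem leviCivitaChristoffel_extensionMetric_fst {z : V × (V →L[ℝ] ℝ)}
    (hΓ : ContDiffAt ℝ 1 Γ z.1) (hΦ : ContDiffAt ℝ 1 Φ z.1) (A B : V × (V →L[ℝ] ℝ)) :
    (leviCivitaChristoffel (extensionMetric Γ Φ) z A B).1 = Γ z.1 A.1 B.1 := by
  refine (SeparatingDual.eq_iff_forall_dual_eq (R := ℝ)).2 fun ν => ?_
  have := leviCivitaChristoffel_spec (extensionMetric Γ Φ) z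
    (isInvertible_extensionForm (Γ z.1) (Φ z.1) z.2) A B (0, ν)
  simp only [fderiv_extensionMetric_apply hΓ hΦ] at this
  simp [extensionMetric] at this
  linarith

/-- The vertical part of the Levi-Civita connection of the extension, which is affine in the fibre
coordinate `z.2`. -/
theorem leviCivitaChristoffel_extensionMetric_snd_apply {z : V × (V →L[ℝ] ℝ)}
    (hΓ : ContDiffAt ℝ 1 Γ z.1) (hΦ : ContDiffAt ℝ 1 Φ z.1) (A B : V × (V →L[ℝ] ℝ)) (w : V) :
    (leviCivitaChristoffel (extensionMetric Γ Φ) z A B).2 w =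
      -A.2 (Γ z.1 B.1 w) - B.2 (Γ z.1 A.1 w)
        + z.2 (fderiv ℝ Γ z.1 w A.1 B.1 - fderiv ℝ Γ z.1 A.1 B.1 w - fderiv ℝ Γ z.1 B.1 A.1 w
          + (2 : ℝ) • Γ z.1 (Γ z.1 A.1 B.1) w)
        + ((fderiv ℝ Φ z.1 A.1 B.1 w + fderiv ℝ Φ z.1 B.1 A.1 w - fderiv ℝ Φ z.1 w A.1 B.1) / 2
          - Φ z.1 (Γ z.1 A.1 B.1) w) := by
  have := leviCivitaChristoffel_spec (extensionMetric Γ Φ) z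
    (isInvertible_extensionForm (Γ z.1) (Φ z.1) z.2) A B (w, 0)
  simp only [fderiv_extensionMetric_apply hΓ hΦ] at this
  simp [extensionMetric, leviCivitaChristoffel_extensionMetric_fst hΓ hΦ] at this
  simp
  linarith

end Christoffel

section Curvature

variable [FiniteDimensional ℝ V]

/-- The Jacobi operator of the extension is block triangular: it induces the Jacobi operator of the
base on the quotient by the vertical subspace, and acts as its transpose on that subspace. -/
theorem spec_jacobi_extensionMetric {z : V × (V →L[ℝ] ℝ)} (hΓ : ContDiffAt ℝ 2 Γ z.1)
    (hΦ : ContDiffAt ℝ 2 Φ z.1) (hsymm : ∀ x u v, Γ x u v = Γ x v u) (X : V × (V →L[ℝ] ℝ)) :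
    spec (jacobi (leviCivitaChristoffel (extensionMetric Γ Φ)) z X) =
      spec (jacobi Γ z.1 X.1) := by
  set L := leviCivitaChristoffel (extensionMetric Γ Φ) with hL
  have hΓd := (hΓ.differentiableAt two_ne_zero).hasFDerivAt
  have hΓ₁ : ContDiffAt ℝ 1 Γ z.1 := hΓ.of_le (by norm_num)
  have hΦ₁ : ContDiffAt ℝ 1 Φ z.1 := hΦ.of_le (by norm_num)
  have hev : ∀ᶠ x in nhds z, ContDiffAt ℝ 1 Γ x.1 ∧ ContDiffAt ℝ 1 Φ x.1 :=
    continuous_fst.continuousAt.eventually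
      ((hΓ₁.eventually (by simp)).and (hΦ₁.eventually (by simp)))
  have hLd : DifferentiableAt ℝ L z :=
    differentiableAt_leviCivitaChristoffel (contDiffAt_extensionMetric hΓ hΦ)
      (isInvertible_extensionForm (Γ z.1) (Φ z.1) z.2)
  have hLAB (A B : V × (V →L[ℝ] ℝ)) : HasFDerivAt (fun x => L x A B)
      (((fderiv ℝ L z).flip A).flip B) z := by
    have := (hLd.hasFDerivAt.clm_apply (hasFDerivAt_const A z)).clm_apply (hasFDerivAt_const B z)
    exact this.congr_fderiv (by ext <;> simp)
  have hΓ_symm (u v w : V) : fderiv ℝ Γ z.1 u v w = fderiv ℝ Γ z.1 u w v := by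
    have e₁ := (hΓd.clm_apply (hasFDerivAt_const v z.1)).clm_apply (hasFDerivAt_const w z.1)
    have e₂ := (hΓd.clm_apply (hasFDerivAt_const w z.1)).clm_apply (hasFDerivAt_const v z.1)
    have e₃ := e₁.unique (e₂.congr_of_eventuallyEq (.of_forall fun x => hsymm x v w))
    simpa using congrArg (fun f : V →L[ℝ] V => f u) e₃
  -- The derivatives are those of the explicit expressions for the entries of `L` near `z`.
  have hfst (A B C : V × (V →L[ℝ] ℝ)) :
      (fderiv ℝ L z C A B).1 = fderiv ℝ Γ z.1 C.1 A.1 B.1 := by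
    have e₁ := (hLAB A B).fst
    have e₂ := ((hΓd.comp z (hasFDerivAt_fst (𝕜 := ℝ) (p := z))).clm_apply
      (hasFDerivAt_const A.1 z)).clm_apply (hasFDerivAt_const B.1 z)
    have e₃ := e₁.unique (e₂.congr_of_eventuallyEq (hev.mono fun x hx =>
      leviCivitaChristoffel_extensionMetric_fst hx.1 hx.2 A B))
    simpa using congrArg (fun f : V × (V →L[ℝ] ℝ) →L[ℝ] V => f C) e₃
  have hsnd (B C : V × (V →L[ℝ] ℝ)) (η : V →L[ℝ] ℝ) (w : V) :
      (fderiv ℝ L z C (0, η) B).2 w = -η (fderiv ℝ Γ z.1 C.1 B.1 w) := by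
    have e₁ := (hLAB (0, η) B).snd.clm_apply (hasFDerivAt_const w z)
    have e₂ := (η.hasFDerivAt.comp z (((hΓd.comp z (hasFDerivAt_fst (𝕜 := ℝ) (p := z))).clm_apply
      (hasFDerivAt_const B.1 z)).clm_apply (hasFDerivAt_const w z))).neg
    have e₃ := e₁.unique (e₂.congr_of_eventuallyEq (hev.mono fun x hx => by
      change (leviCivitaChristoffel (extensionMetric Γ Φ) x (0, η) B).2 w = -η (Γ x.1 B.1 w)
      rw [leviCivitaChristoffel_extensionMetric_snd_apply hx.1 hx.2]
      simp))
    simpa using congrArg (fun f : V × (V →L[ℝ] ℝ) →L[ℝ] ℝ => f C) e₃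
  -- In vertical directions the entries are affine functions of the fibre coordinate.
  have hvert (A B : V × (V →L[ℝ] ℝ)) (η : V →L[ℝ] ℝ) (w : V) :
      (fderiv ℝ L z (0, η) A B).2 w =
        η (fderiv ℝ Γ z.1 w A.1 B.1 - fderiv ℝ Γ z.1 A.1 B.1 w - fderiv ℝ Γ z.1 B.1 A.1 w
          + (2 : ℝ) • Γ z.1 (Γ z.1 A.1 B.1) w) := by
    have hline : HasFDerivAt (fun y : V →L[ℝ] ℝ => (z.1, y))
        (ContinuousLinearMap.inr ℝ V (V →L[ℝ] ℝ)) z.2 := hasFDerivAt_prodMk_right z.1 z.2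
    have e₁ := ((hLAB A B).comp z.2 hline).snd.clm_apply (hasFDerivAt_const w z.2)
    have e₂ := (((hasFDerivAt_id z.2).clm_apply (hasFDerivAt_const
      (fderiv ℝ Γ z.1 w A.1 B.1 - fderiv ℝ Γ z.1 A.1 B.1 w - fderiv ℝ Γ z.1 B.1 A.1 w
          + (2 : ℝ) • Γ z.1 (Γ z.1 A.1 B.1) w) z.2)).const_add
      (-A.2 (Γ z.1 B.1 w) - B.2 (Γ z.1 A.1 w))).add_const
      ((fderiv ℝ Φ z.1 A.1 B.1 w + fderiv ℝ Φ z.1 B.1 A.1 w - fderiv ℝ Φ z.1 w A.1 B.1) / 2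
          - Φ z.1 (Γ z.1 A.1 B.1) w)
    have e₃ := e₁.unique (e₂.congr_of_eventuallyEq (.of_forall fun y =>
      leviCivitaChristoffel_extensionMetric_snd_apply (z := (z.1, y)) hΓ₁ hΦ₁ A B w))
    simpa using congrArg (fun f : (V →L[ℝ] ℝ) →L[ℝ] ℝ => f η) e₃
  have hLfst := leviCivitaChristoffel_extensionMetric_fst (z := z) hΓ₁ hΦ₁
  have hLsnd := leviCivitaChristoffel_extensionMetric_snd_apply (z := z) hΓ₁ hΦ₁
  rw [← hL] at hLfst hLsnd
  refine spec_eq_of_blockTriangular _ _ (fun Y => ?_) (fun η w => ?_)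
  · simp [jacobi, curvature, hfst, hLfst]
  · simp [jacobi, curvature, hvert, hsnd, hLfst, hLsnd, hΓ_symm X.1 w X.1,
      hsymm z.1 w (Γ z.1 X.1 X.1), hsymm z.1 w X.1]
    ring

end Curvature

end LocalExtension

/-! ### Coordinate frames and torsion -/

section Frames

variable {E : Type*} [NormedAddCommGroup E] [NormedSpace ℝ E]
  {H : Type*} [TopologicalSpace H] {I : ModelWithCorners ℝ E H}
  {M : Type*} [TopologicalSpace M] [ChartedSpace H M] [IsManifold I ∞ M]

theorem coordFrame_coordComponents {p q : M} (hq : q ∈ (chartAt H p).source)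
    (v : TangentSpace I q) : coordFrame I p q (coordComponents I p q v) = v :=
  (trivializationAt E (TangentSpace I : M → Type _) p).symmL_continuousLinearMapAt
    (R := ℝ) hq v

theorem coordComponents_coordFrame {p q : M} (hq : q ∈ (chartAt H p).source) (u : E) :
    coordComponents I p q (coordFrame I p q u) = u :=
  (trivializationAt E (TangentSpace I : M → Type _) p).continuousLinearMapAt_symmL
    (R := ℝ) hq u

theorem coordComponents_eq_mfderiv {p q : M} (hq : q ∈ (chartAt H p).source) :
    coordComponents I p q = mfderiv I 𝓘(ℝ, E) (extChartAt I p) q :=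
  TangentBundle.continuousLinearMapAt_trivializationAt hq

theorem hasFDerivAt_transition [I.Boundaryless] {p p' q : M} (hq : q ∈ (chartAt H p).source)
    (hq' : q ∈ (chartAt H p').source) :
    HasFDerivAt (extChartAt I p' ∘ (extChartAt I p).symm)
      (coordComponents I p' q ∘L coordFrame I p q) (extChartAt I p q) := by
  have h := hasFDerivWithinAt_tangentCoordChange (I := I) (x := p) (y := p') (z := q)
    (by simp [hq, hq'])
  rw [I.range_eq_univ, hasFDerivWithinAt_univ] at h
  refine h.congr_fderiv ?_
  ext v
  rw [coordComponents, coordFrame,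
    TangentBundle.continuousLinearMapAt_trivializationAt_eq_core hq',
    TangentBundle.symmL_trivializationAt_eq_core hq]
  exact (tangentCoordChange_comp (I := I) (w := p) (x := q) (y := p') (z := q) (v := v)
    (by simp [hq, hq'])).symm

/-- The constant vector field with value `u` on a vector space. -/
def constField (u : E) (x : E) : TangentSpace 𝓘(ℝ, E) x := u

/-- The vector field with constant components `u` in the preferred chart at `p` is the pullback by
that chart of a constant vector field. -/
theorem coordFrame_eq_mpullback {p q : M} (hq : q ∈ (chartAt H p).source) (u : E) :
    coordFrame I p q u =
      VectorField.mpullback I 𝓘(ℝ, E) (extChartAt I p) (constField u) q := by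
  rw [VectorField.mpullback_apply, ← coordComponents_eq_mfderiv hq]
  let e : TangentSpace I q ≃L[ℝ] E := ContinuousLinearEquiv.equivOfInverse
    (coordComponents I p q) (coordFrame I p q) (coordFrame_coordComponents hq)
    (coordComponents_coordFrame hq)
  exact (congrArg (fun f : E →L[ℝ] TangentSpace I q => f u)
    (ContinuousLinearMap.inverse_equiv e)).symm

theorem eventually_mem_chartAt_source {p q : M} (hq : q ∈ (chartAt H p).source) :
    ∀ᶠ q' in nhds q, q' ∈ (chartAt H p).source :=
  (chartAt H p).open_source.mem_nhds hq

theorem mlieBracket_coordFrame [CompleteSpace E] {p q : M} (hq : q ∈ (chartAt H p).source)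
    (u v : E) : VectorField.mlieBracket I (fun q => coordFrame I p q u)
      (fun q => coordFrame I p q v) q = 0 := by
  have : IsManifold I (minSmoothness ℝ 2) M := by simp; infer_instance
  have hc (w : E) : MDifferentiableAt 𝓘(ℝ, E) (𝓘(ℝ, E).prod 𝓘(ℝ, E))
      (fun x : E => (⟨x, constField w x⟩ : TotalSpace E (TangentSpace 𝓘(ℝ, E) : E → Type _)))
      (extChartAt I p q) :=
    ((contMDiffAt_vectorSpace_iff_contDiffAt (n := 1)).2 contDiffAt_const).mdifferentiableAt
      one_ne_zero
  have h := VectorField.mpullback_mlieBracket (n := 2) (hc u) (hc v)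
    (contMDiffAt_extChartAt' (n := 2) hq) (by simp)
  have h₀ : VectorField.mlieBracket 𝓘(ℝ, E) (constField u) (constField v) = 0 := by
    rw [← VectorField.mlieBracketWithin_univ]
    funext x
    rw [VectorField.mlieBracketWithin_eq_lieBracketWithin]
    change fderivWithin ℝ (fun _ : E => v) Set.univ x u -
      fderivWithin ℝ (fun _ : E => u) Set.univ x v = 0
    simp
  rw [Filter.EventuallyEq.mlieBracket_vectorField_eq
    ((eventually_mem_chartAt_source hq).mono fun q' hq' => coordFrame_eq_mpullback hq' u)
    ((eventually_mem_chartAt_source hq).mono fun q' hq' => coordFrame_eq_mpullback hq' v)]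
  refine h.symm.trans ?_
  rw [VectorField.mpullback_apply, h₀]
  exact map_zero _

section Christoffel

variable [FiniteDimensional ℝ E]
  (D : CovariantDerivative I E (TangentSpace I : M → Type _))

/-- Coordinate vector fields commute, so a torsion-free connection has symmetric Christoffel
symbols. Off the chart domain both sides vanish by convention. -/
theorem christoffel_symm (hD : D.torsion = 0) (p q : M) (u v : E) :
    christoffel I D p q u v = christoffel I D p q v u := by
  by_cases hq : q ∈ (chartAt H p).source
  · have hq' : q ∈ (trivializationAt E (TangentSpace I : M → Type _) p).baseSet := hq
    have h := (CovariantDerivative.torsion_eq_zero_iff D).1 hD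
      (mdifferentiableAt_coordFrame I p q u hq') (mdifferentiableAt_coordFrame I p q v hq')
    have h₁ := mlieBracket_coordFrame (I := I) hq u v
    rw [christoffel_apply, christoffel_apply, ← sub_eq_zero, ← map_sub]
    erw [h, h₁]
    exact map_zero _
  · rw [christoffel_apply, christoffel_apply, coordComponents_eq_zero I p q hq]
    simp

end Christoffel

end Frames

/-! ### Change of coordinates of the Christoffel symbols -/

section Transformation

variable {E : Type*} [NormedAddCommGroup E] [NormedSpace ℝ E]
  {H : Type*} [TopologicalSpace H] (I : ModelWithCorners ℝ E H)
  {M : Type*} [TopologicalSpace M] [ChartedSpace H M] [IsManifold I ∞ M]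

/-- The derivative, at the point with coordinates `x` in the preferred chart at `p`, of the
transition map from that chart to the preferred chart at `p'`. -/
def transitionDeriv (p p' : M) (x : E) : E →L[ℝ] E :=
  coordComponents I p' ((extChartAt I p).symm x) ∘L coordFrame I p ((extChartAt I p).symm x)

variable {I}

theorem transitionDeriv_extChartAt {p q : M} (hq : q ∈ (chartAt H p).source) (p' : M) :
    transitionDeriv I p p' (extChartAt I p q) = coordComponents I p' q ∘L coordFrame I p q := by
  have h : (extChartAt I p).symm (extChartAt I p q) = q :=
    (extChartAt I p).left_inv (by simpa using hq)
  unfold transitionDeriv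
  rw [h]

variable [I.Boundaryless]

theorem contDiffAt_transition {p p' q : M} (hq : q ∈ (chartAt H p).source)
    (hq' : q ∈ (chartAt H p').source) :
    ContDiffAt ℝ ∞ (extChartAt I p' ∘ (extChartAt I p).symm) (extChartAt I p q) := by
  have h := contDiffWithinAt_ext_coord_change (I := I) (n := ∞) p' p (y := extChartAt I p q) (by
    rw [PartialEquiv.trans_source'', PartialEquiv.symm_symm, PartialEquiv.symm_target]
    exact Set.mem_image_of_mem _ (by simp [hq, hq']))
  rwa [I.range_eq_univ, contDiffWithinAt_univ] at h

omit [IsManifold I ∞ M] in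
theorem eventually_extChartAt_symm_mem {p p' q : M} (hq : q ∈ (chartAt H p).source)
    (hq' : q ∈ (chartAt H p').source) :
    ∀ᶠ x in nhds (extChartAt I p q), (extChartAt I p).symm x ∈ (chartAt H p).source ∧
      (extChartAt I p).symm x ∈ (chartAt H p').source ∧
      extChartAt I p ((extChartAt I p).symm x) = x := by
  have hs : q ∈ (extChartAt I p).source := by simpa using hq
  have h₁ : Filter.Tendsto (extChartAt I p).symm (nhds (extChartAt I p q)) (nhds q) := by
    have := continuousAt_extChartAt_symm' hs
    rwa [ContinuousAt, (extChartAt I p).left_inv hs] at this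
  have h₂ : (extChartAt I p).target ∈ nhds (extChartAt I p q) := 
    extChartAt_target_mem_nhds' ((extChartAt I p).map_source hs)
  filter_upwards [h₁.eventually (eventually_mem_chartAt_source hq),
    h₁.eventually (eventually_mem_chartAt_source hq'), h₂] with x h₃ h₄ h₅
  exact ⟨h₃, h₄, (extChartAt I p).right_inv h₅⟩

theorem transitionDeriv_eventuallyEq {p p' q : M} (hq : q ∈ (chartAt H p).source)
    (hq' : q ∈ (chartAt H p').source) :
    transitionDeriv I p p' =ᶠ[nhds (extChartAt I p q)]
      fderiv ℝ (extChartAt I p' ∘ (extChartAt I p).symm) := by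
  filter_upwards [eventually_extChartAt_symm_mem hq hq'] with x hx
  have h := (hasFDerivAt_transition (I := I) hx.1 hx.2.1).fderiv
  rw [hx.2.2] at h
  exact h.symm

theorem contDiffAt_transitionDeriv {p p' q : M} (hq : q ∈ (chartAt H p).source)
    (hq' : q ∈ (chartAt H p').source) :
    ContDiffAt ℝ ∞ (transitionDeriv I p p') (extChartAt I p q) :=
  ((contDiffAt_transition hq hq').fderiv_right (m := ∞) (by simp)).congr_of_eventuallyEq
    (transitionDeriv_eventuallyEq hq hq')

/-- Symmetry of the second derivative of the transition map. -/
theorem fderiv_transitionDeriv_symm {p p' q : M} (hq : q ∈ (chartAt H p).source)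
    (hq' : q ∈ (chartAt H p').source) (a b : E) :
    fderiv ℝ (transitionDeriv I p p') (extChartAt I p q) a b =
      fderiv ℝ (transitionDeriv I p p') (extChartAt I p q) b a := by
  rw [(transitionDeriv_eventuallyEq hq hq').fderiv_eq]
  exact ((contDiffAt_transition hq hq').isSymmSndFDerivAt
    (by simpa using ENat.LEInfty.out)).eq a b

section Leibniz

variable {D : CovariantDerivative I E (TangentSpace I : M → Type _)}

omit [I.Boundaryless] in
/-- The Leibniz rule for a finite linear combination of vector fields. -/
theorem covariantDerivative_sum {ι : Type*} (s : Finset ι) (f : ι → M → ℝ)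
    (σ : ι → ∀ q : M, TangentSpace I q) {q : M}
    (hf : ∀ i, MDifferentiableAt I 𝓘(ℝ, ℝ) (f i) q)
    (hσ : ∀ i, MDifferentiableAt I (I.prod 𝓘(ℝ, E)) (fun q => TotalSpace.mk' E q (σ i q)) q) :
    D (fun q => ∑ i ∈ s, (f i • σ i) q) q =
      ∑ i ∈ s, (f i q • D (σ i) q + (mvfderiv I (f i) q).smulRight (σ i q)) := by
  classical
  induction s using Finset.induction_on with
  | empty =>
    simp only [Finset.sum_empty]
    exact congrFun D.zero q
  | insert i s hi ih =>
    simp only [Finset.sum_insert hi]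
    rw [← ih, ← D.isCovariantDerivativeOnUniv.leibniz (hσ i) (hf i)]
    exact D.isCovariantDerivativeOnUniv.add ((hf i).smul_section (hσ i))
      (MDifferentiableAt.sum_section fun i _ => (hf i).smul_section (hσ i))

end Leibniz

variable [FiniteDimensional ℝ E]

/-- The transformation law of Christoffel symbols under a change of coordinates. -/
theorem christoffel_transition (D : CovariantDerivative I E (TangentSpace I : M → Type _))
    {p p' q : M} (hq : q ∈ (chartAt H p).source) (hq' : q ∈ (chartAt H p').source) (a b : E) :
    transitionDeriv I p p' (extChartAt I p q) (christoffel I D p q a b) =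
      christoffel I D p' q (transitionDeriv I p p' (extChartAt I p q) a)
        (transitionDeriv I p p' (extChartAt I p q) b) +
        fderiv ℝ (transitionDeriv I p p') (extChartAt I p q) a b := by
  let e := Module.finBasis ℝ E
  let l (i) : E →L[ℝ] ℝ := LinearMap.toContinuousLinearMap (e.coord i)
  let A := transitionDeriv I p p'
  let x := extChartAt I p q
  let h (i) (x : E) : ℝ := l i (A x b)
  let f (i) (q' : M) : ℝ := h i (extChartAt I p q')
  have hAd : HasFDerivAt A (fderiv ℝ A x) x :=
    ((contDiffAt_transitionDeriv hq hq').differentiableAt (by simp)).hasFDerivAt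
  have hh (i) : HasFDerivAt (h i) (l i ∘L (fderiv ℝ A x).flip b) x :=
    ((l i).hasFDerivAt.comp x (hAd.clm_apply (hasFDerivAt_const b x))).congr_fderiv
      (by ext; simp)
  have hc : MDifferentiableAt I 𝓘(ℝ, E) (extChartAt I p) q :=
    (contMDiffAt_extChartAt' (n := 1) hq).mdifferentiableAt one_ne_zero
  have hf (i) : HasMFDerivAt I 𝓘(ℝ, ℝ) (f i) q
      ((l i ∘L (fderiv ℝ A x).flip b) ∘L mfderiv I 𝓘(ℝ, E) (extChartAt I p) q) :=
    HasMFDerivAt.comp (g := h i) (f := extChartAt I p) q (hh i).hasMFDerivAt hc.hasMFDerivAt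
  have hdf (i) : mvfderiv I (f i) q (coordFrame I p q a) = l i (fderiv ℝ A x a b) := by
    have h₁ : mvfderiv I (f i) q (coordFrame I p q a) =
        l i (fderiv ℝ A x (mfderiv I 𝓘(ℝ, E) (extChartAt I p) q (coordFrame I p q a)) b) := by
      rw [mvfderiv, (hf i).mfderiv]
      rfl
    rw [h₁, ← coordComponents_eq_mfderiv hq]
    erw [coordComponents_coordFrame hq]
  have hsum (y : E) : ∑ i, l i y • e i = y := e.sum_repr y
  -- The frame of the chart at `p` is expanded in the frame of the chart at `p'`.
  have hframe : ∀ᶠ q' in nhds q, coordFrame I p q' b =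
      ∑ i, (f i • fun q' => coordFrame I p' q' (e i)) q' := by
    filter_upwards [eventually_mem_chartAt_source hq, eventually_mem_chartAt_source hq']
      with q' h₁ h₂
    have h₃ : ∑ i, (f i • fun q' => coordFrame I p' q' (e i)) q' =
        coordFrame I p' q' (∑ i, l i (A (extChartAt I p q') b) • e i) := by
      simp [f, h, map_sum]
    rw [h₃, hsum]
    simp only [A, transitionDeriv_extChartAt h₁]
    exact (coordFrame_coordComponents h₂ _).symm
  have hσ (i) := mdifferentiableAt_coordFrame I p' q (e i) hq'
  have hD := IsCovariantDerivativeOn.congr_of_eventuallyEq D.isCovariantDerivativeOnUniv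
    (mdifferentiableAt_coordFrame I p q b hq)
    (MDifferentiableAt.sum_section fun i (_ : i ∈ Finset.univ) =>
      (hf i).mdifferentiableAt.smul_section (hσ i)) Filter.univ_mem hframe
  have hD' := hD.trans (covariantDerivative_sum Finset.univ f _
    (fun i => (hf i).mdifferentiableAt) hσ)
  have hA (y : E) : coordFrame I p' q (A x y) = coordFrame I p q y := by
    simp only [A, x, transitionDeriv_extChartAt hq]
    exact coordFrame_coordComponents hq' _
  have hL : A x (christoffel I D p q a b) =
      coordComponents I p' q (D (fun q' => coordFrame I p q' b) q (coordFrame I p q a)) := by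
    simp only [A, x, transitionDeriv_extChartAt hq, christoffel_apply]
    exact congrArg _ (coordFrame_coordComponents hq _)
  have hterm (i) : coordComponents I p' q
      ((f i q • D (fun q' => coordFrame I p' q' (e i)) q +
        (mvfderiv I (f i) q).smulRight (coordFrame I p' q (e i))) (coordFrame I p q a)) =
      l i (A x b) • christoffel I D p' q (A x a) (e i) + l i (fderiv ℝ A x a b) • e i := by
    rw [christoffel_apply, hA]
    refine (map_add _ _ _).trans (congrArg₂ (· + ·) (map_smul _ _ _) ?_)
    exact (map_smul _ _ _).trans
      (congrArg₂ (fun (c : ℝ) (v : E) => c • v) (hdf i) (coordComponents_coordFrame hq' _))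
  refine hL.trans ?_
  rw [hD', sum_apply, map_sum, Finset.sum_congr rfl fun i _ => hterm i, Finset.sum_add_distrib,
    hsum]
  congr 1
  conv_rhs => rw [← hsum (A x b)]
  simp only [map_sum, map_smul]
  rfl

end Transformation

/-! ### Smoothness in coordinates -/

section Smoothness

variable {E : Type*} [NormedAddCommGroup E] [NormedSpace ℝ E]
  {H : Type*} [TopologicalSpace H] {I : ModelWithCorners ℝ E H}
  {M : Type*} [TopologicalSpace M] [ChartedSpace H M] [IsManifold I ∞ M]

theorem contMDiffOn_coordFrame (p : M) (v : E) :
    ContMDiffOn I (I.prod 𝓘(ℝ, E)) ∞ (fun q => TotalSpace.mk' E q (coordFrame I p q v))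
      (chartAt H p).source := by
  have h : ContMDiffOn I (I.prod 𝓘(ℝ, E)) ∞
      (fun q => TotalSpace.mk' E q (coordFrame I p q v))
      (trivializationAt E (TangentSpace I : M → Type _) p).baseSet := by
    rw [Trivialization.contMDiffOn_section_baseSet_iff]
    refine (contMDiffOn_const (c := v)).congr ?_
    intro y hy
    rw [coordFrame, Trivialization.symmL_apply _ hy]
    exact congrArg Prod.snd (Trivialization.apply_mk_symm _ hy v)
  exact h

/-- A coordinate vector field agrees near any given point with a global smooth vector field. -/
theorem exists_global_extension_coordFrame [FiniteDimensional ℝ E] [T2Space M] {p q : M}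
    (hq : q ∈ (chartAt H p).source) (v : E) :
    ∃ σ : ∀ q : M, TangentSpace I q,
      ContMDiff I (I.prod 𝓘(ℝ, E)) ∞ (fun q => TotalSpace.mk' E q (σ q)) ∧
      ∀ᶠ q' in nhds q, σ q' = coordFrame I p q' v := by
  obtain ⟨ψ, -, hψ⟩ := (SmoothBumpFunction.nhds_basis_tsupport (I := I) q).mem_iff.1
    ((chartAt H p).open_source.mem_nhds hq)
  refine ⟨(ψ : M → ℝ) • fun q => coordFrame I p q v,
    ContMDiffOn.smul_section_of_tsupport ψ.contMDiff.contMDiffOn (chartAt H p).open_source hψ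
      (contMDiffOn_coordFrame p v), ?_⟩
  filter_upwards [ψ.eventuallyEq_one] with q' h
  simp [h]

theorem contDiffOn_extChartAt_target_of_contMDiffOn {W : Type*} [NormedAddCommGroup W]
    [NormedSpace ℝ W] {n : WithTop ℕ∞} (hn : n ≤ ∞) {f : M → W} {p : M}
    (hf : ContMDiffOn I 𝓘(ℝ, W) n f (chartAt H p).source) :
    ContDiffOn ℝ n (f ∘ (extChartAt I p).symm) (extChartAt I p).target := by
  rw [← contMDiffOn_iff_contDiffOn]
  refine hf.comp ((contMDiffOn_extChartAt_symm (n := ∞) p).of_le hn) fun z hz => ?_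
  simpa using (extChartAt I p).map_target hz

/-- Smoothness of a connection is a statement about global vector fields, so the coordinate fields
are first replaced by global extensions of their germs. -/
theorem contDiffOn_christoffel [FiniteDimensional ℝ E] [T2Space M]
    (D : CovariantDerivative I E (TangentSpace I : M → Type _))
    (hD : D.ContMDiffCovariantDerivative ∞) (p : M) :
    ContDiffOn ℝ ∞ (fun z => christoffel I D p ((extChartAt I p).symm z))
      (extChartAt I p).target := by
  rw [contDiffOn_clm_apply]
  intro u
  rw [contDiffOn_clm_apply]
  intro v
  refine contDiffOn_extChartAt_target_of_contMDiffOn (f := fun q => christoffel I D p q u v)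
    le_rfl fun q hq => ContMDiffAt.contMDiffWithinAt ?_
  obtain ⟨σ, hσ, hσv⟩ := exists_global_extension_coordFrame (I := I) hq v
  have h₁ := (hD.contMDiff.contMDiff (σ := σ) (by simpa using! hσ.contMDiffOn)).contMDiffAt
    (Filter.univ_mem (f := nhds q))
  have h₂ := (contMDiffOn_coordFrame (I := I) p u).contMDiffAt
    ((chartAt H p).open_source.mem_nhds hq)
  have h₃ := h₁.clm_bundle_apply h₂
  have h₄ := ((trivializationAt E (TangentSpace I : M → Type _) p).contMDiffAt_section_iff
    (s := fun q' => D σ q' (coordFrame I p q' u)) (IB := I) (n := ∞) (x₀ := q) hq).1 h₃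
  refine h₄.congr_of_eventuallyEq ?_
  filter_upwards [eventually_mem_chartAt_source hq, hσv.eventually_nhds] with q' h₅ h₆
  have h₇ := IsCovariantDerivativeOn.congr_of_eventuallyEq D.isCovariantDerivativeOnUniv
    ((hσ q').mdifferentiableAt (by simp)) (mdifferentiableAt_coordFrame I p q' v h₅)
    Filter.univ_mem h₆
  have hb : q' ∈ (trivializationAt E (TangentSpace I : M → Type _) p).baseSet := h₅
  rw [christoffel_apply, coordComponents, Trivialization.continuousLinearMapAt_apply,
    Trivialization.coe_linearMapAt_of_mem _ hb, h₇]

theorem contDiffOn_localComponents [FiniteDimensional ℝ E]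
    {h : ∀ p : M, TangentSpace I p →L[ℝ] TangentSpace I p →L[ℝ] ℝ}
    (hh : IsSmoothTwoTensor I h) (p : M) :
    ContDiffOn ℝ ∞ (localComponents I h p) (extChartAt I p).target := by
  rw [contDiffOn_clm_apply]
  intro u
  rw [contDiffOn_clm_apply]
  intro v
  refine contDiffOn_extChartAt_target_of_contMDiffOn
    (f := fun q => h q (coordFrame I p q u) (coordFrame I p q v))
    le_rfl fun q hq => ContMDiffAt.contMDiffWithinAt ?_
  have hu (w) := (contMDiffOn_coordFrame (I := I) p w).contMDiffAt
    ((chartAt H p).open_source.mem_nhds hq)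
  have h₁ := ContMDiffAt.clm_bundle_apply₂ (F₃ := ℝ) (E₃ := Bundle.Trivial M ℝ) (IB := I)
    (hh q) (hu u) (hu v)
  exact (contMDiffAt_totalSpace.1 h₁).2

/-- It suffices to check smoothness of a 2-tensor at the centre of each preferred chart. -/
theorem isSmoothTwoTensor_of_localComponents
    {h : ∀ p : M, TangentSpace I p →L[ℝ] TangentSpace I p →L[ℝ] ℝ}
    (hh : ∀ p, ContDiffAt ℝ ∞ (localComponents I h p) (extChartAt I p p)) :
    IsSmoothTwoTensor I h := by
  intro p
  refine (contMDiffAt_hom_bundle (IB := I) _).2 ⟨contMDiffAt_id, ?_⟩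
  have h₁ : ContMDiffAt I 𝓘(ℝ, E →L[ℝ] E →L[ℝ] ℝ) ∞
      (localComponents I h p ∘ extChartAt I p) p :=
    (hh p).contMDiffAt.comp p contMDiffAt_extChartAt
  refine h₁.congr_of_eventuallyEq ?_
  filter_upwards [eventually_mem_chartAt_source (mem_chart_source H p)] with q hq
  ext u v
  have hb : q ∈ (trivializationAt E (TangentSpace I : M → Type _) p).baseSet := hq
  have h₂ : (extChartAt I p).symm (extChartAt I p q) = q :=
    (extChartAt I p).left_inv (by simpa using hq)
  refine (inCoordinates_apply_eq₂ (E₃ := Bundle.Trivial M ℝ) hb hb (Set.mem_univ q)).trans ?_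
  simp only [localComponents, Function.comp_apply, pullbackForm_apply]
  rw [h₂]
  simp [coordFrame, Trivialization.symmL_apply _ hb]

end Smoothness

/-! ### Canonical coordinates on the cotangent bundle -/

section Cotangent

variable {E : Type*} [NormedAddCommGroup E] [NormedSpace ℝ E]
  {H : Type*} [TopologicalSpace H] {I : ModelWithCorners ℝ E H}
  {M : Type*} [TopologicalSpace M] [ChartedSpace H M] [IsManifold I ∞ M]

theorem mem_chartAt_source_cotangentBundle {ξ ξ' : CotangentBundle I M} :
    ξ' ∈ (chartAt (ModelProd H (E →L[ℝ] ℝ)) ξ).source ↔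
      ξ'.proj ∈ (chartAt H ξ.proj).source := by
  rw [FiberBundle.chartedSpace_chartAt]
  simp only [mfld_simps]
  exact ⟨fun h => h.1.1, fun h => ⟨⟨h, Set.mem_univ _⟩, h⟩⟩

/-- The preferred charts of the cotangent bundle are the canonical coordinates `(x, y)`. -/
theorem extChartAt_cotangentBundle (ξ ξ' : CotangentBundle I M) :
    extChartAt (I.prod 𝓘(ℝ, E →L[ℝ] ℝ)) ξ ξ' =
      (extChartAt I ξ.proj ξ'.proj, ξ'.snd ∘L coordFrame I ξ.proj ξ'.proj) := by
  rw [FiberBundle.extChartAt]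
  refine Prod.ext rfl ?_
  change ContinuousLinearMap.inCoordinates E (TangentSpace I : M → Type _) ℝ (Bundle.Trivial M ℝ)
    ξ.proj ξ'.proj ξ.proj ξ'.proj ξ'.snd = _
  ext v
  simp [ContinuousLinearMap.inCoordinates, coordFrame]

variable [I.Boundaryless]

/-- The derivative of `x ↦ (Dφ x)⁻¹` for a transition map `φ`, obtained by differentiating
`(Dφ x)⁻¹ (Dφ x) b = b`. -/
theorem hasFDerivAt_transitionDeriv_inverse {p p' q : M} (hq : q ∈ (chartAt H p).source)
    (hq' : q ∈ (chartAt H p').source) :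
    ∃ B' : E →L[ℝ] E →L[ℝ] E,
      HasFDerivAt (fun x => transitionDeriv I p' p
        (extChartAt I p' ((extChartAt I p).symm x))) B' (extChartAt I p q) ∧
      ∀ a b, B' a (transitionDeriv I p p' (extChartAt I p q) b) =
        -(coordComponents I p q (coordFrame I p' q
          (fderiv ℝ (transitionDeriv I p p') (extChartAt I p q) a b))) := by
  have hφ : (extChartAt I p' ∘ (extChartAt I p).symm) (extChartAt I p q) = extChartAt I p' q := by
    rw [Function.comp_apply, (extChartAt I p).left_inv (by simpa using hq)]
  have h₁ := ((contDiffAt_transition (I := I) hq hq').differentiableAt (by simp)).hasFDerivAt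
  have h₂ := ((contDiffAt_transitionDeriv (I := I) hq' hq).differentiableAt (by simp)).hasFDerivAt
  have h₃ := ((contDiffAt_transitionDeriv (I := I) hq hq').differentiableAt (by simp)).hasFDerivAt
  rw [← hφ] at h₂
  have hB := h₂.comp _ h₁
  refine ⟨_, hB, fun a b => ?_⟩
  have h₄ := hB.clm_apply (h₃.clm_apply (hasFDerivAt_const b (extChartAt I p q)))
  have h₅ := h₄.unique ((hasFDerivAt_const b (extChartAt I p q)).congr_of_eventuallyEq (by
    filter_upwards [eventually_extChartAt_symm_mem hq hq'] with x hx
    have h₆ := transitionDeriv_extChartAt (I := I) hx.2.1 p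
    simp only [Function.comp_apply, h₆]
    simp only [transitionDeriv]
    exact (congrArg _ (coordFrame_coordComponents hx.2.1 _)).trans
      (coordComponents_coordFrame hx.1 b)))
  have h₇ := congrArg (fun f : E →L[ℝ] E => f a) h₅
  simp only [Function.comp_apply] at h₇
  rw [eq_neg_iff_add_eq_zero, add_comm]
  have h₈ : transitionDeriv I p' p ((extChartAt I p') ((extChartAt I p).symm
      (extChartAt I p q))) = coordComponents I p q ∘L coordFrame I p' q := by
    rw [(extChartAt I p).left_inv (by simpa using hq), transitionDeriv_extChartAt hq' p]
  rw [h₈] at h₇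
  simpa using h₇

/-- Two preferred charts of the cotangent bundle change coordinates by
`(x, y) ↦ (φ x, y ∘ (Dφ x)⁻¹)`; this is the derivative of that map. -/
theorem coordComponents_coordFrame_cotangentBundle {ξ ξ₁ ξ' : CotangentBundle I M}
    (hξ : ξ'.proj ∈ (chartAt H ξ.proj).source) (hξ₁ : ξ'.proj ∈ (chartAt H ξ₁.proj).source)
    {B' : E →L[ℝ] E →L[ℝ] E}
    (hB' : HasFDerivAt (fun x => transitionDeriv I ξ₁.proj ξ.proj
        (extChartAt I ξ₁.proj ((extChartAt I ξ.proj).symm x))) B' (extChartAt I ξ.proj ξ'.proj))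
    (X : E × (E →L[ℝ] ℝ)) :
    coordComponents (I.prod 𝓘(ℝ, E →L[ℝ] ℝ)) ξ₁ ξ'
      (coordFrame (I.prod 𝓘(ℝ, E →L[ℝ] ℝ)) ξ ξ' X) =
      (transitionDeriv I ξ.proj ξ₁.proj (extChartAt I ξ.proj ξ'.proj) X.1,
        X.2 ∘L (coordComponents I ξ.proj ξ'.proj ∘L coordFrame I ξ₁.proj ξ'.proj) +
          (ξ'.snd ∘L coordFrame I ξ.proj ξ'.proj) ∘L B' X.1) := by
  have hs := mem_chartAt_source_cotangentBundle.2 hξ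
  have hs₁ := mem_chartAt_source_cotangentBundle.2 hξ₁
  have h₁ := hasFDerivAt_transition (I := I.prod 𝓘(ℝ, E →L[ℝ] ℝ)) hs hs₁
  set z := extChartAt (I.prod 𝓘(ℝ, E →L[ℝ] ℝ)) ξ ξ' with hz
  have hz' : z = (extChartAt I ξ.proj ξ'.proj, ξ'.snd ∘L coordFrame I ξ.proj ξ'.proj) :=
    extChartAt_cotangentBundle ξ ξ'
  have hz₁ : z.1 = extChartAt I ξ.proj ξ'.proj := by rw [hz']
  have hz₂ : z.2 = ξ'.snd ∘L coordFrame I ξ.proj ξ'.proj := by rw [hz']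
  rw [← hz₁] at hB'
  have h₂ : HasFDerivAt (extChartAt I ξ₁.proj ∘ (extChartAt I ξ.proj).symm)
      (transitionDeriv I ξ.proj ξ₁.proj z.1) z.1 := by
    rw [hz₁, transitionDeriv_extChartAt hξ]
    exact hasFDerivAt_transition hξ hξ₁
  have h₃ := (h₂.comp z hasFDerivAt_fst).prodMk
    (hasFDerivAt_snd.clm_comp (hB'.comp z hasFDerivAt_fst))
  have h₄ := h₁.unique (h₃.congr_of_eventuallyEq (by
    filter_upwards [eventually_extChartAt_symm_mem (I := I.prod 𝓘(ℝ, E →L[ℝ] ℝ)) hs hs₁] with w hw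
    obtain ⟨hw₁, hw₂, hw₃⟩ := hw
    set ζ := (extChartAt (I.prod 𝓘(ℝ, E →L[ℝ] ℝ)) ξ).symm w with hζ
    rw [mem_chartAt_source_cotangentBundle] at hw₁ hw₂
    have hw₄ : w = (extChartAt I ξ.proj ζ.proj, ζ.snd ∘L coordFrame I ξ.proj ζ.proj) := by
      rw [← extChartAt_cotangentBundle, hw₃]
    rw [Function.comp_apply, ← hζ, extChartAt_cotangentBundle, hw₄]
    simp only [Function.comp_apply]
    rw [(extChartAt I ξ.proj).left_inv (by simpa using hw₁), transitionDeriv_extChartAt hw₂]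
    refine Prod.ext rfl ?_
    ext v
    exact congrArg ζ.snd (coordFrame_coordComponents hw₁ _).symm))
  have h₅ := congrArg (fun f : E × (E →L[ℝ] ℝ) →L[ℝ] E × (E →L[ℝ] ℝ) => f X) h₄
  refine h₅.trans ?_
  rw [← hz₁, ← hz₂]
  have h₆ : transitionDeriv I ξ₁.proj ξ.proj (extChartAt I ξ₁.proj ((extChartAt I ξ.proj).symm
      z.1)) = coordComponents I ξ.proj ξ'.proj ∘L coordFrame I ξ₁.proj ξ'.proj := by
    rw [hz₁, (extChartAt I ξ.proj).left_inv (by simpa using hξ), transitionDeriv_extChartAt hξ₁]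
  refine Prod.ext (by simp) ?_
  ext v
  change z.2 (B' X.1 v) + X.2 (transitionDeriv I ξ₁.proj ξ.proj (extChartAt I ξ₁.proj
    ((extChartAt I ξ.proj).symm z.1)) v) = _
  rw [h₆, add_comm]
  rfl

section Extension

variable [FiniteDimensional ℝ E]
  (D : CovariantDerivative I E (TangentSpace I : M → Type _))
  (Φ : ∀ p : M, TangentSpace I p →L[ℝ] TangentSpace I p →L[ℝ] ℝ)

/-- In the canonical coordinates of any preferred chart, the deformed Riemannian extension is given
by the expression which defines it at the centre of the chart. -/
theorem localComponents_deformedRiemannianExtension (ξ : CotangentBundle I M) {z : E × (E →L[ℝ] ℝ)}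
    (hz : z ∈ (extChartAt (I.prod 𝓘(ℝ, E →L[ℝ] ℝ)) ξ).target) :
    localComponents (I.prod 𝓘(ℝ, E →L[ℝ] ℝ)) (deformedRiemannianExtension I D Φ) ξ z =
      extensionMetric (fun x => christoffel I D ξ.proj ((extChartAt I ξ.proj).symm x))
        (localComponents I Φ ξ.proj) z := by
  have hs : (extChartAt (I.prod 𝓘(ℝ, E →L[ℝ] ℝ)) ξ).symm z ∈
      (chartAt (ModelProd H (E →L[ℝ] ℝ)) ξ).source := by
    simpa only [extChartAt_source] using
      (extChartAt (I.prod 𝓘(ℝ, E →L[ℝ] ℝ)) ξ).map_target hz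
  have hz' := (extChartAt (I.prod 𝓘(ℝ, E →L[ℝ] ℝ)) ξ).right_inv hz
  unfold localComponents
  set ξ' := (extChartAt (I.prod 𝓘(ℝ, E →L[ℝ] ℝ)) ξ).symm z
  rw [mem_chartAt_source_cotangentBundle] at hs
  have hs' := mem_chart_source H ξ'.proj
  rw [extChartAt_cotangentBundle] at hz'
  obtain ⟨B', hB', hB'A⟩ := hasFDerivAt_transitionDeriv_inverse (I := I) hs hs'
  have hleft : (extChartAt I ξ.proj).symm (extChartAt I ξ.proj ξ'.proj) = ξ'.proj :=
    (extChartAt I ξ.proj).left_inv (by simpa using hs)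
  have hAapply (v : E) : coordFrame I ξ'.proj ξ'.proj
      (transitionDeriv I ξ.proj ξ'.proj (extChartAt I ξ.proj ξ'.proj) v) =
        coordFrame I ξ.proj ξ'.proj v := by
    rw [transitionDeriv_extChartAt hs]
    exact coordFrame_coordComponents hs' _
  have hΓ (a b : E) := christoffel_transition D hs hs' a b
  have hsymm := fderiv_transitionDeriv_symm (I := I) hs hs'
  have hη (v : E) : ξ'.snd (coordFrame I ξ.proj ξ'.proj
      (coordComponents I ξ.proj ξ'.proj (coordFrame I ξ'.proj ξ'.proj v))) =
      ξ'.snd (coordFrame I ξ'.proj ξ'.proj v) :=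
    congrArg ξ'.snd (coordFrame_coordComponents hs _)
  have hΦ : pullbackForm (Φ ((extChartAt I ξ.proj).symm (extChartAt I ξ.proj ξ'.proj)))
      (coordFrame I ξ.proj ((extChartAt I ξ.proj).symm (extChartAt I ξ.proj ξ'.proj))) =
      pullbackForm (Φ ξ'.proj) (coordFrame I ξ.proj ξ'.proj) := by
    rw [hleft]
  have hΓη (a b : E) : ξ'.snd (coordFrame I ξ'.proj ξ'.proj (christoffel I D ξ'.proj ξ'.proj
      (transitionDeriv I ξ.proj ξ'.proj (extChartAt I ξ.proj ξ'.proj) a)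
      (transitionDeriv I ξ.proj ξ'.proj (extChartAt I ξ.proj ξ'.proj) b))) =
      ξ'.snd (coordFrame I ξ.proj ξ'.proj (christoffel I D ξ.proj ξ'.proj a b)) -
      ξ'.snd (coordFrame I ξ'.proj ξ'.proj (fderiv ℝ (transitionDeriv I ξ.proj ξ'.proj)
        (extChartAt I ξ.proj ξ'.proj) a b)) := by
    rw [eq_sub_iff_add_eq, ← map_add, ← map_add, ← hΓ, hAapply]
  refine ContinuousLinearMap.ext fun X => ContinuousLinearMap.ext fun Y => ?_
  simp only [pullbackForm_apply, deformedRiemannianExtension]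
  rw [coordComponents_coordFrame_cotangentBundle hs hs' hB',
    coordComponents_coordFrame_cotangentBundle hs hs' hB', deformedExtensionLocal_apply, ← hz']
  -- The second derivatives of the transition map occur in `hΓη` and `hB'A`; they cancel by `hsymm`.
  simp only [extensionMetric, extensionForm_apply]
  rw [hΦ]
  simp only [pullbackForm_apply, hleft, add_apply, ContinuousLinearMap.comp_apply, hΓη, hAapply,
    coordComponents_coordFrame hs, hB'A, map_neg, hη, hsymm Y.1 X.1]
  ring

theorem contDiffAt_extensionMetric_chart [T2Space M] {D} {Φ}
    (hD : D.ContMDiffCovariantDerivative ∞)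
    (hΦ : IsSmoothTwoTensor I Φ) (p : M) {z : E × (E →L[ℝ] ℝ)}
    (hz : z.1 ∈ (extChartAt I p).target) :
    ContDiffAt ℝ ∞ (extensionMetric (fun x => christoffel I D p ((extChartAt I p).symm x))
      (localComponents I Φ p)) z :=
  have ht := (isOpen_extChartAt_target (I := I) p).mem_nhds hz
  contDiffAt_extensionMetric ((contDiffOn_christoffel D hD p).contDiffAt ht)
    ((contDiffOn_localComponents hΦ p).contDiffAt ht)

theorem localComponents_deformedRiemannianExtension_eventuallyEq (ξ : CotangentBundle I M) :
    localComponents (I.prod 𝓘(ℝ, E →L[ℝ] ℝ)) (deformedRiemannianExtension I D Φ) ξ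
      =ᶠ[nhds (extChartAt (I.prod 𝓘(ℝ, E →L[ℝ] ℝ)) ξ ξ)]
      extensionMetric (fun x => christoffel I D ξ.proj ((extChartAt I ξ.proj).symm x))
        (localComponents I Φ ξ.proj) :=
  Filter.mem_of_superset (extChartAt_target_mem_nhds ξ) fun _ hz =>
    localComponents_deformedRiemannianExtension D Φ ξ hz

omit [I.Boundaryless] [FiniteDimensional ℝ E] in
theorem extChartAt_cotangentBundle_self_fst (ξ : CotangentBundle I M) :
    (extChartAt (I.prod 𝓘(ℝ, E →L[ℝ] ℝ)) ξ ξ).1 = extChartAt I ξ.proj ξ.proj := by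
  rw [extChartAt_cotangentBundle]

omit [I.Boundaryless] in
theorem deformedRiemannianExtension_apply (ξ : CotangentBundle I M)
    (X Y : TangentSpace (I.prod 𝓘(ℝ, E →L[ℝ] ℝ)) ξ) :
    deformedRiemannianExtension I D Φ ξ X Y =
      extensionForm (christoffel I D ξ.proj ξ.proj)
        (pullbackForm (Φ ξ.proj) (coordFrame I ξ.proj ξ.proj))
        (ξ.snd ∘L coordFrame I ξ.proj ξ.proj)
        (coordComponents (I.prod 𝓘(ℝ, E →L[ℝ] ℝ)) ξ ξ X)
        (coordComponents (I.prod 𝓘(ℝ, E →L[ℝ] ℝ)) ξ ξ Y) := rfl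

theorem isPseudoRiemannianMetric_deformedRiemannianExtension [T2Space M]
    (hD : D.ContMDiffCovariantDerivative ∞) (hD' : D.torsion = 0)
    (hΦ : IsSmoothTwoTensor I Φ) (hΦ' : ∀ p x y, Φ p x y = Φ p y x) :
    IsPseudoRiemannianMetric (I.prod 𝓘(ℝ, E →L[ℝ] ℝ)) (deformedRiemannianExtension I D Φ) where
  smooth := by
    refine isSmoothTwoTensor_of_localComponents fun ξ => ?_
    refine (contDiffAt_extensionMetric_chart hD hΦ ξ.proj ?_).congr_of_eventuallyEq
      (localComponents_deformedRiemannianExtension_eventuallyEq D Φ ξ)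
    rw [extChartAt_cotangentBundle_self_fst]
    exact mem_extChartAt_target ξ.proj
  symm ξ X Y := by
    simp only [deformedRiemannianExtension_apply, extensionForm_apply, pullbackForm_apply]
    rw [christoffel_symm D hD', hΦ']
    ring
  nondegenerate ξ X h := by
    have hξ := mem_chart_source (ModelProd H (E →L[ℝ] ℝ)) ξ
    have h₀ : coordComponents (I.prod 𝓘(ℝ, E →L[ℝ] ℝ)) ξ ξ X = 0 := by
      refine eq_zero_of_extensionForm_eq_zero (christoffel I D ξ.proj ξ.proj)
        (pullbackForm (Φ ξ.proj) (coordFrame I ξ.proj ξ.proj))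
        (ξ.snd ∘L coordFrame I ξ.proj ξ.proj) _ fun B => ?_
      have h₁ := h (coordFrame (I.prod 𝓘(ℝ, E →L[ℝ] ℝ)) ξ ξ B)
      rw [deformedRiemannianExtension_apply, coordComponents_coordFrame hξ] at h₁
      exact h₁
    rw [← coordFrame_coordComponents hξ X, h₀, map_zero]

/-- A tangent vector of `T*M` has the same Jacobi spectrum as its projection to `M`. -/
theorem spec_metricJacobi_deformedRiemannianExtension [T2Space M]
    (hD : D.ContMDiffCovariantDerivative ∞) (hD' : D.torsion = 0)
    (hΦ : IsSmoothTwoTensor I Φ) {ξ : CotangentBundle I M}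
    (X : TangentSpace (I.prod 𝓘(ℝ, E →L[ℝ] ℝ)) ξ) (x : TangentSpace I ξ.proj)
    (hx : coordComponents I ξ.proj ξ.proj x =
      (coordComponents (I.prod 𝓘(ℝ, E →L[ℝ] ℝ)) ξ ξ X).1) :
    spec (metricJacobi (I.prod 𝓘(ℝ, E →L[ℝ] ℝ)) (deformedRiemannianExtension I D Φ) X) =
      spec (affineJacobi I D x) := by
  have ht : (extChartAt I ξ.proj).target ∈
      nhds (extChartAt (I.prod 𝓘(ℝ, E →L[ℝ] ℝ)) ξ ξ).1 := by
    rw [extChartAt_cotangentBundle_self_fst]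
    exact extChartAt_target_mem_nhds ξ.proj
  rw [metricJacobi, jacobi_leviCivitaChristoffel_congr
    (localComponents_deformedRiemannianExtension_eventuallyEq D Φ ξ),
    spec_jacobi_extensionMetric
      (((contDiffOn_christoffel D hD ξ.proj).contDiffAt ht).of_le ENat.LEInfty.out)
      (((contDiffOn_localComponents hΦ ξ.proj).contDiffAt ht).of_le ENat.LEInfty.out)
      (fun _ u v => christoffel_symm D hD' _ _ u v), extChartAt_cotangentBundle_self_fst, ← hx]
  rfl

end Extension

end Cotangent

/-! ### The equivalence -/

section Equivalence

variable {E : Type*} [NormedAddCommGroup E] [NormedSpace ℝ E]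
  {H : Type*} [TopologicalSpace H] {I : ModelWithCorners ℝ E H}
  {M : Type*} [TopologicalSpace M] [ChartedSpace H M] [IsManifold I ∞ M]

/-- Every nonzero vector is the projection of a vector of any prescribed square norm. -/
theorem exists_extensionForm_eq (Γ : E →L[ℝ] E →L[ℝ] E) (Φ : E →L[ℝ] E →L[ℝ] ℝ)
    (y : E →L[ℝ] ℝ) {a : E} (ha : a ≠ 0) (ε : ℝ) :
    ∃ α : E →L[ℝ] ℝ, extensionForm Γ Φ y (a, α) (a, α) = ε := by
  obtain ⟨β, hβ⟩ := SeparatingDual.exists_eq_one (R := ℝ) ha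
  refine ⟨((ε + 2 * y (Γ a a) - Φ a a) / 2) • β, ?_⟩
  simp [hβ]
  ring

variable [I.Boundaryless] [FiniteDimensional ℝ E] [T2Space M]

/-- The affine condition is equivalent to the condition on the pseudosphere of any level `ε ≠ 0`. -/
theorem isAffineProjectiveOsserman_iff
    (D : CovariantDerivative I E (TangentSpace I : M → Type _))
    (hD : D.ContMDiffCovariantDerivative ∞) (hD' : D.torsion = 0)
    (Φ : ∀ p : M, TangentSpace I p →L[ℝ] TangentSpace I p →L[ℝ] ℝ)
    (hΦ : IsSmoothTwoTensor I Φ) (hΦ' : ∀ p x y, Φ p x y = Φ p y x) {ε : ℝ} (hε : ε ≠ 0) :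
    IsAffineProjectiveOsserman I D ↔
      IsProjectiveOssermanOnPseudosphere (I.prod 𝓘(ℝ, E →L[ℝ] ℝ)) ε
        (deformedRiemannianExtension I D Φ) := by
  constructor
  · refine fun h => ⟨isPseudoRiemannianMetric_deformedRiemannianExtension D Φ hD hD' hΦ hΦ',
      fun ξ ζ X Y hX hY => ?_⟩
    have key (ξ : CotangentBundle I M) (X : TangentSpace (I.prod 𝓘(ℝ, E →L[ℝ] ℝ)) ξ)
        (hX : deformedRiemannianExtension I D Φ ξ X X = ε) :
        ∃ x : TangentSpace I ξ.proj, x ≠ 0 ∧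
          spec (metricJacobi (I.prod 𝓘(ℝ, E →L[ℝ] ℝ)) (deformedRiemannianExtension I D Φ) X) =
            spec (affineJacobi I D x) := by
      have hx := coordComponents_coordFrame (I := I) (mem_chart_source H ξ.proj)
        (coordComponents (I.prod 𝓘(ℝ, E →L[ℝ] ℝ)) ξ ξ X).1
      refine ⟨_, fun h₀ => hε ?_,
        spec_metricJacobi_deformedRiemannianExtension D Φ hD hD' hΦ X _ hx⟩
      rw [h₀, map_zero] at hx
      rw [← hX, deformedRiemannianExtension_apply, extensionForm_apply, ← hx]
      simp
    obtain ⟨x, hx, hx'⟩ := key ξ X hX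
    obtain ⟨y, hy, hy'⟩ := key ζ Y hY
    rw [hx', hy']
    exact h _ _ x y hx hy
  · intro h p q x y hx hy
    have key (p : M) (x : TangentSpace I p) (hx : x ≠ 0) :
        ∃ X : TangentSpace (I.prod 𝓘(ℝ, E →L[ℝ] ℝ)) (⟨p, 0⟩ : CotangentBundle I M),
          deformedRiemannianExtension I D Φ ⟨p, 0⟩ X X = ε ∧
          spec (metricJacobi (I.prod 𝓘(ℝ, E →L[ℝ] ℝ)) (deformedRiemannianExtension I D Φ) X) =
            spec (affineJacobi I D x) := by
      have ha : coordComponents I p p x ≠ 0 := fun h₀ => hx (by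
        rw [← coordFrame_coordComponents (mem_chart_source H p) x, h₀, map_zero])
      obtain ⟨α, hα⟩ := exists_extensionForm_eq (christoffel I D p p)
        (pullbackForm (Φ p) (coordFrame I p p)) ((0 : TangentSpace I p →L[ℝ] ℝ) ∘L
          coordFrame I p p) ha ε
      have hX := coordComponents_coordFrame (I := I.prod 𝓘(ℝ, E →L[ℝ] ℝ))
        (mem_chart_source (ModelProd H (E →L[ℝ] ℝ)) (⟨p, 0⟩ : CotangentBundle I M))
        (coordComponents I p p x, α)
      refine ⟨_, ?_, spec_metricJacobi_deformedRiemannianExtension D Φ hD hD' hΦ _ x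
        (congrArg Prod.fst hX).symm⟩
      rw [deformedRiemannianExtension_apply, hX]
      exact hα
    obtain ⟨X, hX, hX'⟩ := key p x hx
    obtain ⟨Y, hY, hY'⟩ := key q y hy
    rw [← hX', ← hY']
    exact h.projEquiv _ _ X Y hX hY

end Equivalence

end Osserman

end
theorem theorem1p8 {m : ℕ} {M : Type*} [TopologicalSpace M] [T2Space M]
    [ChartedSpace (EuclideanSpace ℝ (Fin m)) M] [IsManifold (𝓡 m) ∞ M]
    (D : CovariantDerivative (𝓡 m) (EuclideanSpace ℝ (Fin m)) (TangentSpace (𝓡 m) : M → Type _))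
    (hD : D.ContMDiffCovariantDerivative ∞) (hD' : D.torsion = 0)
    (Φ : ∀ p : M, TangentSpace (𝓡 m) p →L[ℝ] TangentSpace (𝓡 m) p →L[ℝ] ℝ)
    (hΦ : Osserman.IsSmoothTwoTensor (𝓡 m) Φ) (hΦ' : ∀ p x y, Φ p x y = Φ p y x) :
    [Osserman.IsAffineProjectiveOsserman (𝓡 m) D,
      Osserman.IsSpacelikeProjectiveOsserman
        ((𝓡 m).prod 𝓘(ℝ, EuclideanSpace ℝ (Fin m) →L[ℝ] ℝ))
        (Osserman.deformedRiemannianExtension (𝓡 m) D Φ),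
      Osserman.IsTimelikeProjectiveOsserman
        ((𝓡 m).prod 𝓘(ℝ, EuclideanSpace ℝ (Fin m) →L[ℝ] ℝ))
        (Osserman.deformedRiemannianExtension (𝓡 m) D Φ)].TFAE := by
  tfae_have 1 ↔ 2 :=
    Osserman.isAffineProjectiveOsserman_iff D hD hD' Φ hΦ hΦ' one_ne_zero
  tfae_have 1 ↔ 3 :=
    Osserman.isAffineProjectiveOsserman_iff D hD hD' Φ hΦ hΦ' (neg_ne_zero.2 one_ne_zero)
  tfae_finish
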